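/- Conventions. All maps below are between metric spaces. A subset $S$ of $X$ is coarse dense if it is non-empty and, for some $C$, every point of $X$ is at distance at most $C$ from $S$ ($C$-coarse dense). A map $q:X\to Y$ is a $(K,\epsilon)$ quasi-isometric embedding ($K\ge 1$, $\epsilon\ge 0$) if $\frac1K d(x,y)-\epsilon\le d(q(x),q(y))\le K d(x,y)+\epsilon$ for all $x,y$, and a $(K,\epsilon,C)$ quasi-isometry if moreover $q(X)$ is $C$-coarse dense in $Y$. A space is coarse connected if for some $c>0$ any two of its points are joined by a finite sequence of its points with consecutive distances at most $c$. A quasi-action of a group $G$ on $X$ is a map $\alpha:G\times X\to X$ such that for some $K\ge1$, $\epsilon,C\ge0$: each $\alpha(g,\cdot)$ is a $(K,\epsilon,C)$ quasi-isometry of $X$, $d(\alpha(1,x),x)\le C$ and $d(\alpha(g,\alpha(h,x)),\alpha(gh,x))\le C$ for all $x\in X$ and $g,h\in G$. The quasi-orbit of $x$ is $\mathcal Q(x)=\{\alpha(g,x)\mid g\in G\}$, with the metric of $X$; $\alpha$ is cobounded if some quasi-orbit is coarse dense in $X$. For quasi-actions $\alpha$ on $X$ and $\beta$ on $Y$, a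 map $F:X\to Y$ is coarse $G$-equivariant from $\alpha$ to $\beta$ if $d(F(\alpha(g,x)),\beta(g,F(x)))$ is bounded over all $g\in G$, $x\in X$. We say that $\alpha$ reduces to $\beta$ if there is a coarse $G$-equivariant quasi-isometric embedding $Y\to X$ from $\beta$ to $\alpha$, and that $\alpha$ is equivalent to $\beta$ if there is a coarse $G$-equivariant quasi-isometry $X\to Y$ from $\alpha$ to $\beta$. A simplicial tree is the geometric realization of a (non-empty) tree, with the path metric in which every edge has length $1$; it has bounded valence if the valences of its vertices are bounded by a common integer. Theorem. Let $\alpha$ be any quasi-action of any group $G$ on an arbitrary metric space $X$, and let $x_0\in X$ be any point. Then $\alpha$ reduces to some cobounded quasi-action on a bounded valence simplicial tree if and only if the quasi-orbit $\mathcal Q(x_0)$ quasi-isometrically embeds in some proper metric space, quasi-isometrically embeds in some simplicial tree, and is coarse connected. If $\alpha$ is itself cobounded, then $\alpha$ is equivalent to some cobounded quasi-action on a bounded valence simplicial tree if and only if $\mathcal Q(x_0)$ satisfies the same three conditions. -/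

import Mathlib

namespace CoarseGeom

/-! ### Coarse notions for metric spaces -/

/-- `S` is `C`-coarse dense: it is non-empty and every point is at distance at most `C`
from some point of `S`. -/
def CoarseDenseWith {X : Type*} [MetricSpace X] (C : ℝ) (S : Set X) : Prop :=
  S.Nonempty ∧ ∀ x : X, ∃ s ∈ S, dist x s ≤ C

/-- `S` is coarse dense in `X`. -/
def CoarseDense {X : Type*} [MetricSpace X] (S : Set X) : Prop :=
  ∃ C : ℝ, 0 < C ∧ CoarseDenseWith C S

/-- Any two points are joined by a finite sequence of points with jumps at most `c`,
for some uniform `c > 0`. -/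
def CoarseConnected (X : Type*) [MetricSpace X] : Prop :=
  ∃ c : ℝ, 0 < c ∧ ∀ x y : X, Relation.ReflTransGen (fun a b : X => dist a b ≤ c) x y

/-- `q` satisfies the `(K, ε)` quasi-isometric embedding inequalities. -/
def QIEmbeddingWith {X Y : Type*} [MetricSpace X] [MetricSpace Y] (K ε : ℝ) (q : X → Y) :
    Prop :=
  ∀ x y : X, (1 / K) * dist x y - ε ≤ dist (q x) (q y) ∧
    dist (q x) (q y) ≤ K * dist x y + ε

/-- `q` is a quasi-isometric embedding. -/
def IsQIEmbedding {X Y : Type*} [MetricSpace X] [MetricSpace Y] (q : X → Y) : Prop :=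
  ∃ K ε : ℝ, 1 ≤ K ∧ 0 ≤ ε ∧ QIEmbeddingWith K ε q

/-- `q` is a `(K, ε, C)` quasi-isometry: a `(K, ε)` quasi-isometric embedding whose image is
`C`-coarse dense. -/
def QuasiIsometryWith {X Y : Type*} [MetricSpace X] [MetricSpace Y] (K ε C : ℝ) (q : X → Y) :
    Prop :=
  QIEmbeddingWith K ε q ∧ CoarseDenseWith C (Set.range q)

/-- `q` is a quasi-isometry. -/
def IsQuasiIsometry {X Y : Type*} [MetricSpace X] [MetricSpace Y] (q : X → Y) : Prop :=
  ∃ K ε C : ℝ, 1 ≤ K ∧ 0 ≤ ε ∧ 0 ≤ C ∧ QuasiIsometryWith K ε C q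

/-! ### Quasi-actions -/

/-- `α` is a `(K, ε, C)` quasi-action of `G` on `X`. -/
structure QuasiActionWith {G X : Type*} [Group G] [MetricSpace X] (K ε C : ℝ)
    (α : G → X → X) : Prop where
  quasiIsometry : ∀ g : G, QuasiIsometryWith K ε C (α g)
  one : ∀ x : X, dist (α 1 x) x ≤ C
  mul : ∀ (x : X) (g h : G), dist (α g (α h x)) (α (g * h) x) ≤ C

/-- `α` is a quasi-action of `G` on `X`. -/
def IsQuasiAction {G X : Type*} [Group G] [MetricSpace X] (α : G → X → X) : Prop :=
  ∃ K ε C : ℝ, 1 ≤ K ∧ 0 ≤ ε ∧ 0 ≤ C ∧ QuasiActionWith K ε C α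

/-- The quasi-orbit of `x`. -/
def quasiOrbit {G X : Type*} (α : G → X → X) (x : X) : Set X :=
  Set.range fun g : G => α g x

/-- Some quasi-orbit is coarse dense. -/
def Cobounded {G X : Type*} [MetricSpace X] (α : G → X → X) : Prop :=
  ∃ x₀ : X, CoarseDense (quasiOrbit α x₀)

/-- `F` is coarse `G`-equivariant from `α` on `X` to `β` on `Y`. -/
def CoarseEquivariant {G X Y : Type*} [MetricSpace Y] (α : G → X → X)
    (β : G → Y → Y) (F : X → Y) : Prop :=
  ∃ M : ℝ, 0 ≤ M ∧ ∀ (x : X) (g : G), dist (F (α g x)) (β g (F x)) ≤ M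

/-- The quasi-action `α` on `X` reduces to the quasi-action `β` on `Y`: there is a coarse
`G`-equivariant quasi-isometric embedding from `β` to `α`. -/
def ReducesTo {G X Y : Type*} [MetricSpace X] [MetricSpace Y] (α : G → X → X)
    (β : G → Y → Y) : Prop :=
  ∃ F : Y → X, IsQIEmbedding F ∧ CoarseEquivariant β α F

/-- The quasi-actions `α` and `β` are equivalent: there is a coarse `G`-equivariant
quasi-isometry from `α` to `β`. -/
def EquivalentTo {G X Y : Type*} [MetricSpace X] [MetricSpace Y] (α : G → X → X)
    (β : G → Y → Y) : Prop :=
  ∃ F : X → Y, IsQuasiIsometry F ∧ CoarseEquivariant α β F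

/-! ### Simplicial trees as metric spaces -/

/-- A combinatorial tree. Its geometric realization is the type `SimplicialTree.Realization`. -/
structure SimplicialTree.{u} where
  /-- the vertices -/
  Vertex : Type u
  /-- the edges -/
  graph : SimpleGraph Vertex
  isTree : graph.IsTree

namespace SimplicialTree

/-- The number of edges at a vertex is bounded. -/
def BoundedValence (T : SimplicialTree) : Prop :=
  ∃ N : ℕ, ∀ v : T.Vertex, (T.graph.neighborSet v).encard ≤ N

/-- `s` is contained in the vertex set of a simplex (a vertex or an edge) of `T`. -/
def InSimplex (T : SimplicialTree) (s : Set T.Vertex) : Prop :=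
  ∃ u v : T.Vertex, (u = v ∨ T.graph.Adj u v) ∧ s ⊆ {u, v}

/-- The geometric realization of `T`, in barycentric coordinates: finitely supported non-negative
weights on the vertices, with sum `1`, which are carried by a vertex or an edge. -/
@[ext]
structure Realization (T : SimplicialTree) where
  coord : T.Vertex →₀ ℝ
  nonneg : ∀ v, 0 ≤ coord v
  sum_eq_one : (coord.sum fun _ r => r) = 1
  inSimplex : T.InSimplex coord.support

namespace Realization

variable {T : SimplicialTree}

theorem support_nonempty (b : T.Realization) : b.coord.support.Nonempty := by
  rw [Finset.nonempty_iff_ne_empty]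
  intro h
  have h1 := b.sum_eq_one
  rw [Finsupp.sum, h, Finset.sum_empty] at h1
  exact zero_ne_one h1

/-- Two points lie in a common closed edge (or are the same vertex). -/
def SameEdge (b c : T.Realization) : Prop :=
  T.InSimplex (b.coord.support ∪ c.coord.support)

/-- The length of the segment between two points of the same edge, for edges of length `1`. -/
noncomputable def segLength (b c : T.Realization) : ℝ :=
  ((b.coord - c.coord).sum fun _ r => |r|) / 2

/-- The length of a shortest path from `b` to `c` that goes through vertices: it runs from `b` to
an endpoint `u` of its edge, then along edges to an endpoint `v` of the edge of `c`, then
to `c`. The point `b` is at distance `1 - b.coord u` from `u`. -/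
noncomputable def viaVertices (b c : T.Realization) : ℝ :=
  (b.coord.support ×ˢ c.coord.support).inf' (b.support_nonempty.product c.support_nonempty)
    fun p => (1 - b.coord p.1) + (T.graph.dist p.1 p.2 : ℝ) + (1 - c.coord p.2)

open Classical in
/-- The path metric in which every edge has length `1`. -/
noncomputable def pathDist (b c : T.Realization) : ℝ :=
  if SameEdge b c then segLength b c else viaVertices b c

theorem SameEdge.symm {b c : T.Realization} (h : SameEdge b c) : SameEdge c b := by
  unfold SameEdge at h ⊢
  rwa [Set.union_comm]

theorem coord_le_one (b : T.Realization) (v : T.Vertex) : b.coord v ≤ 1 := by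
  by_cases hv : v ∈ b.coord.support
  · rw [← b.sum_eq_one]
    exact Finset.single_le_sum (f := fun v => b.coord v) (fun i _ => b.nonneg i) hv
  · rw [Finsupp.notMem_support_iff.1 hv]
    exact zero_le_one

theorem sum_eq_of_subset (b : T.Realization) (s : Finset T.Vertex)
    (hs : b.coord.support ⊆ s) : ∑ v ∈ s, b.coord v = 1 := by
  rw [← b.sum_eq_one, Finsupp.sum]
  symm
  exact Finset.sum_subset hs fun v _ hv => Finsupp.notMem_support_iff.1 hv

theorem segLength_eq (b c : T.Realization) (s : Finset T.Vertex)
    (hb : b.coord.support ⊆ s) (hc : c.coord.support ⊆ s) :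
    segLength b c = (∑ v ∈ s, |b.coord v - c.coord v|) / 2 := by
  classical
  unfold segLength Finsupp.sum
  congr 1
  refine Finset.sum_subset (Finsupp.support_sub.trans (Finset.union_subset hb hc)) ?_
  intro v _ hv
  rw [Finsupp.notMem_support_iff] at hv
  simp only [hv, abs_zero]

theorem segLength_self (b : T.Realization) : segLength b b = 0 := by
  simp [segLength]

theorem segLength_comm (b c : T.Realization) : segLength b c = segLength c b := by
  classical
  rw [segLength_eq b c (b.coord.support ∪ c.coord.support) Finset.subset_union_left
    Finset.subset_union_right, segLength_eq c b (b.coord.support ∪ c.coord.support)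
    Finset.subset_union_right Finset.subset_union_left]
  simp only [abs_sub_comm]

theorem segLength_triangle (a b c : T.Realization) :
    segLength a c ≤ segLength a b + segLength b c := by
  classical
  set s := a.coord.support ∪ b.coord.support ∪ c.coord.support
  have ha : a.coord.support ⊆ s := by grind
  have hb : b.coord.support ⊆ s := by grind
  have hc : c.coord.support ⊆ s := by grind
  rw [segLength_eq a c s ha hc, segLength_eq a b s ha hb, segLength_eq b c s hb hc,
    ← add_div, ← Finset.sum_add_distrib]
  gcongr
  exact abs_sub_le _ _ _

theorem eq_of_segLength_le (b c : T.Realization) (h : segLength b c ≤ 0) : b = c := by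
  classical
  have h1 := segLength_eq b c (b.coord.support ∪ c.coord.support) Finset.subset_union_left
    Finset.subset_union_right
  have h0 : ∑ v ∈ b.coord.support ∪ c.coord.support, |b.coord v - c.coord v| = 0 :=
    le_antisymm (by linarith) (Finset.sum_nonneg fun _ _ => abs_nonneg _)
  rw [Finset.sum_eq_zero_iff_of_nonneg fun _ _ => abs_nonneg _] at h0
  ext v
  by_cases hv : v ∈ b.coord.support ∪ c.coord.support
  · exact sub_eq_zero.1 (abs_eq_zero.1 (h0 v hv))
  · rw [Finset.mem_union, not_or, Finsupp.notMem_support_iff, Finsupp.notMem_support_iff] at hv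
    rw [hv.1, hv.2]

theorem viaVertices_le {b c : T.Realization} {u v : T.Vertex} (hu : u ∈ b.coord.support)
    (hv : v ∈ c.coord.support) :
    viaVertices b c ≤ (1 - b.coord u) + (T.graph.dist u v : ℝ) + (1 - c.coord v) :=
  Finset.inf'_le (s := b.coord.support ×ˢ c.coord.support) (b := (u, v))
    (fun p => (1 - b.coord p.1) + (T.graph.dist p.1 p.2 : ℝ) + (1 - c.coord p.2))
    (Finset.mem_product.2 ⟨hu, hv⟩)

theorem exists_viaVertices_eq (b c : T.Realization) :
    ∃ u ∈ b.coord.support, ∃ v ∈ c.coord.support,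
      viaVertices b c = (1 - b.coord u) + (T.graph.dist u v : ℝ) + (1 - c.coord v) := by
  obtain ⟨p, hp, h⟩ := Finset.exists_mem_eq_inf'
    (b.support_nonempty.product c.support_nonempty)
    fun p => (1 - b.coord p.1) + (T.graph.dist p.1 p.2 : ℝ) + (1 - c.coord p.2)
  rw [Finset.mem_product] at hp
  exact ⟨p.1, hp.1, p.2, hp.2, h⟩

theorem viaVertices_comm (b c : T.Realization) : viaVertices b c = viaVertices c b := by
  have key : ∀ b c : T.Realization, viaVertices b c ≤ viaVertices c b := by
    intro b c
    obtain ⟨u, hu, v, hv, h⟩ := exists_viaVertices_eq c b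
    have := viaVertices_le hv hu
    rw [SimpleGraph.dist_comm] at this
    linarith
  exact le_antisymm (key b c) (key c b)

theorem viaVertices_nonneg (b c : T.Realization) : 0 ≤ viaVertices b c := by
  obtain ⟨u, -, v, -, h⟩ := exists_viaVertices_eq b c
  have := b.coord_le_one u
  have := c.coord_le_one v
  have : (0 : ℝ) ≤ T.graph.dist u v := Nat.cast_nonneg _
  linarith

theorem SameEdge.cases {b c : T.Realization} (h : SameEdge b c) :
    b = c ∨ ∃ u v, T.graph.Adj u v ∧ (∀ x ∈ b.coord.support, x = u ∨ x = v) ∧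
      (∀ x ∈ c.coord.support, x = u ∨ x = v) ∧
      b.coord u + b.coord v = 1 ∧ c.coord u + c.coord v = 1 ∧
      segLength b c = |b.coord u - c.coord u| := by
  classical
  obtain ⟨u, v, huv, hs⟩ := h
  have hb : b.coord.support ⊆ ({u, v} : Finset T.Vertex) := by
    intro w hw
    simpa using hs (Or.inl hw)
  have hc : c.coord.support ⊆ ({u, v} : Finset T.Vertex) := by
    intro w hw
    simpa using hs (Or.inr hw)
  have sb := b.sum_eq_of_subset _ hb
  have sc := c.sum_eq_of_subset _ hc
  have sl := segLength_eq b c _ hb hc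
  rcases huv with rfl | huv
  · left
    apply eq_of_segLength_le
    simp only [Finset.mem_singleton, Finset.insert_eq_of_mem, Finset.sum_singleton] at sb sc sl
    rw [sl, sb, sc]
    simp
  · right
    rw [Finset.sum_pair huv.ne] at sb sc sl
    refine ⟨u, v, huv, fun x hx => by simpa using hb hx, fun x hx => by simpa using hc hx, sb, sc, ?_⟩
    have h2 : b.coord v - c.coord v = -(b.coord u - c.coord u) := by linarith
    rw [sl, h2, abs_neg]
    ring

theorem segLength_le_viaVertices {b c : T.Realization} (h : SameEdge b c) :
    segLength b c ≤ viaVertices b c := by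
  rcases h.cases with rfl | ⟨u, v, huv, hb, hc, sb, sc, sl⟩
  · rw [segLength_self]
    exact viaVertices_nonneg _ _
  · obtain ⟨x, hx, y, hy, h⟩ := exists_viaVertices_eq b c
    have hx' := hb x hx
    have hy' := hc y hy
    have h1 : (T.graph.dist u v : ℝ) = 1 := by
      exact_mod_cast SimpleGraph.dist_eq_one_iff_adj.2 huv
    have h2 : (T.graph.dist v u : ℝ) = 1 := by rw [SimpleGraph.dist_comm, h1]
    have := b.nonneg u
    have := b.nonneg v
    have := c.nonneg u
    have := c.nonneg v
    rw [h, sl, abs_le]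
    rcases hx' with rfl | rfl <;> rcases hy' with rfl | rfl <;>
      simp only [h1, h2, SimpleGraph.dist_self, Nat.cast_zero] <;>
      constructor <;> linarith

theorem viaVertices_le_segLength_add {a b : T.Realization} (h : SameEdge a b)
    (c : T.Realization) : viaVertices a c ≤ segLength a b + viaVertices b c := by
  rcases h.cases with rfl | ⟨u, v, huv, ha, hb, sa, sb, sl⟩
  · rw [segLength_self, zero_add]
  · obtain ⟨x, hx, y, hy, h⟩ := exists_viaVertices_eq b c
    have key : ∀ x z, T.graph.Adj x z → a.coord x + a.coord z = 1 → b.coord x + b.coord z = 1 →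
        segLength a b = |a.coord x - b.coord x| →
        viaVertices b c = (1 - b.coord x) + (T.graph.dist x y : ℝ) + (1 - c.coord y) →
        viaVertices a c ≤ segLength a b + viaVertices b c := by
      intro x z hxz ha' hb' hl hv
      rw [hl, hv]
      have h3 := neg_abs_le (a.coord x - b.coord x)
      by_cases hxa : x ∈ a.coord.support
      · have := viaVertices_le hxa hy
        linarith
      · rw [Finsupp.notMem_support_iff] at hxa
        have hz : z ∈ a.coord.support := by
          rw [Finsupp.mem_support_iff]
          intro h0
          rw [hxa, h0] at ha'
          norm_num at ha'
        have h4 := viaVertices_le hz hy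
        have h5 : (T.graph.dist z y : ℝ) ≤ T.graph.dist z x + T.graph.dist x y := by
          exact_mod_cast T.isTree.connected.dist_triangle
        have h6 : (T.graph.dist z x : ℝ) = 1 := by
          exact_mod_cast SimpleGraph.dist_eq_one_iff_adj.2 hxz.symm
        linarith
    have hx' := hb x hx
    rcases hx' with rfl | rfl
    · exact key x v huv sa sb sl h
    · refine key x u huv.symm (by linarith) (by linarith) ?_ h
      have h2 : a.coord x - b.coord x = -(a.coord u - b.coord u) := by linarith
      rw [sl, h2, abs_neg]

theorem viaVertices_le_segLength {b c : T.Realization} (h : SameEdge b c) {x : T.Vertex}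
    (hx : b.coord x = 1) : viaVertices b c ≤ segLength b c := by
  have hxb : x ∈ b.coord.support := by
    rw [Finsupp.mem_support_iff, hx]
    exact one_ne_zero
  have hbb : viaVertices b b ≤ 0 := by
    have := viaVertices_le hxb hxb
    rw [SimpleGraph.dist_self, hx] at this
    simpa using this
  have := viaVertices_le_segLength_add h.symm b
  rw [viaVertices_comm, segLength_comm b c]
  linarith

theorem viaVertices_triangle (a b c : T.Realization) :
    viaVertices a c ≤ viaVertices a b + viaVertices b c := by
  obtain ⟨u, hu, v, hv, h1⟩ := exists_viaVertices_eq a b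
  obtain ⟨v', hv', w, hw, h2⟩ := exists_viaVertices_eq b c
  have h3 := viaVertices_le hu hw
  have t1 : (T.graph.dist u w : ℝ) ≤ T.graph.dist u v + T.graph.dist v w := by
    exact_mod_cast T.isTree.connected.dist_triangle
  have t2 : (T.graph.dist v w : ℝ) ≤ T.graph.dist v v' + T.graph.dist v' w := by
    exact_mod_cast T.isTree.connected.dist_triangle
  have t3 : (T.graph.dist v v' : ℝ) ≤ (1 - b.coord v) + (1 - b.coord v') := by
    by_cases hvv : v = v'
    · subst hvv
      have := b.coord_le_one v
      rw [SimpleGraph.dist_self, Nat.cast_zero]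
      linarith
    · classical
      have hs : b.coord v + b.coord v' ≤ 1 := by
        have := Finset.sum_le_sum_of_subset_of_nonneg (f := fun i => b.coord i)
          (s := {v, v'}) (t := b.coord.support) (by grind) (fun i _ _ => b.nonneg i)
        rw [Finset.sum_pair hvv] at this
        exact this.trans b.sum_eq_one.le
      obtain ⟨p, q, hpq, hsub⟩ := b.inSimplex
      have e1 := hsub hv
      have e2 := hsub hv'
      simp only [Set.mem_insert_iff, Set.mem_singleton_iff] at e1 e2
      have hadj : T.graph.Adj v v' := by
        rcases hpq with rfl | hpq
        · grind
        · rcases e1 with rfl | rfl <;> rcases e2 with rfl | rfl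
          · exact absurd rfl hvv
          · exact hpq
          · exact hpq.symm
          · exact absurd rfl hvv
      have : (T.graph.dist v v' : ℝ) = 1 := by
        exact_mod_cast SimpleGraph.dist_eq_one_iff_adj.2 hadj
      linarith
  linarith

theorem exists_coord_eq_one_or (b : T.Realization) :
    (∃ x, b.coord x = 1) ∨
      ∀ a : T.Realization, SameEdge a b → a.coord.support ⊆ b.coord.support := by
  classical
  by_cases hx : ∃ x, b.coord x = 1
  · exact Or.inl hx
  · right
    intro a hab
    rcases hab.cases with rfl | ⟨u, v, huv, ha, hb, sa, sb, -⟩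
    · exact Finset.Subset.refl _
    · intro w hw
      have hw' := ha w hw
      rw [Finsupp.mem_support_iff]
      intro h0
      apply hx
      rcases hw' with rfl | rfl
      · exact ⟨v, by linarith⟩
      · exact ⟨u, by linarith⟩

theorem pathDist_triangle (a b c : T.Realization) :
    pathDist a c ≤ pathDist a b + pathDist b c := by
  unfold pathDist
  by_cases hab : SameEdge a b <;> by_cases hbc : SameEdge b c <;> by_cases hac : SameEdge a c <;>
    simp only [hab, hbc, hac, if_true, if_false]
  · exact segLength_triangle a b c
  · rcases exists_coord_eq_one_or b with ⟨x, hx⟩ | hb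
    · have h1 := viaVertices_le_segLength_add hab c
      have h2 := viaVertices_le_segLength hbc hx
      linarith
    · exfalso
      apply hac
      obtain ⟨p, q, hpq, hs⟩ := b.inSimplex
      exact ⟨p, q, hpq, Set.union_subset (fun w hw => hs (hb a hab hw))
        fun w hw => hs (hb c hbc.symm hw)⟩
  · have h1 := viaVertices_le_segLength_add hab c
    have h2 := segLength_le_viaVertices hac
    linarith
  · exact viaVertices_le_segLength_add hab c
  · have h1 := viaVertices_le_segLength_add hbc.symm a
    have h2 := segLength_le_viaVertices hac
    rw [viaVertices_comm c a, viaVertices_comm b a, segLength_comm c b] at h1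
    linarith
  · have h1 := viaVertices_le_segLength_add hbc.symm a
    rw [viaVertices_comm c a, viaVertices_comm b a, segLength_comm c b] at h1
    linarith
  · have h1 := viaVertices_triangle a b c
    have h2 := segLength_le_viaVertices hac
    linarith
  · exact viaVertices_triangle a b c

theorem pathDist_self (b : T.Realization) : pathDist b b = 0 := by
  unfold pathDist
  have h : SameEdge b b := by
    unfold SameEdge
    rw [Set.union_self]
    exact b.inSimplex
  rw [if_pos h, segLength_self]

theorem pathDist_comm (b c : T.Realization) : pathDist b c = pathDist c b := by
  unfold pathDist
  by_cases h : SameEdge b c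
  · rw [if_pos h, if_pos h.symm, segLength_comm]
  · rw [if_neg h, if_neg fun h' => h h'.symm, viaVertices_comm]

theorem eq_of_pathDist_eq_zero {b c : T.Realization} (h : pathDist b c = 0) : b = c := by
  unfold pathDist at h
  by_cases hs : SameEdge b c
  · rw [if_pos hs] at h
    exact eq_of_segLength_le b c h.le
  · rw [if_neg hs] at h
    exfalso
    obtain ⟨u, hu, v, hv, h'⟩ := exists_viaVertices_eq b c
    have h1 := b.coord_le_one u
    have h2 := c.coord_le_one v
    have h3 : (0 : ℝ) ≤ T.graph.dist u v := Nat.cast_nonneg _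
    have h4 : (T.graph.dist u v : ℝ) = 0 := by linarith
    have h5 : u = v := T.isTree.connected.dist_eq_zero_iff.1 (by exact_mod_cast h4)
    subst h5
    have key : ∀ b : T.Realization, b.coord u = 1 → (b.coord.support : Set T.Vertex) ⊆ {u} := by
      classical
      intro b hb w hw
      by_contra hwu
      have := Finset.sum_le_sum_of_subset_of_nonneg (f := fun i => b.coord i)
        (s := {w, u}) (t := b.coord.support)
        (by
          intro i hi
          simp only [Finset.mem_insert, Finset.mem_singleton] at hi
          rcases hi with rfl | rfl
          · exact hw
          · rw [Finsupp.mem_support_iff, hb]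
            exact one_ne_zero)
        (fun i _ _ => b.nonneg i)
      rw [Finset.sum_pair hwu, hb] at this
      have h6 := this.trans b.sum_eq_one.le
      have h7 : b.coord w = 0 := le_antisymm (by linarith) (b.nonneg w)
      exact Finsupp.mem_support_iff.1 hw h7
    refine hs ⟨u, u, Or.inl rfl, ?_⟩
    rw [Set.pair_eq_singleton]
    exact Set.union_subset (key b (by linarith)) (key c (by linarith))

noncomputable instance : MetricSpace T.Realization where
  dist := pathDist
  dist_self := pathDist_self
  dist_comm := pathDist_comm
  dist_triangle := pathDist_triangle
  eq_of_dist_eq_zero := eq_of_pathDist_eq_zero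

end Realization
end SimplicialTree
end CoarseGeom

open CoarseGeom

universe u v w

/-! Everything is decided by the coarse geometry of the quasi-orbit `O` of `x₀`. If `α` reduces to a
cobounded `β` on `Y`, pairing `α g x₀` with `β g y₀` is a quasi-isometry `O → Y`
(`ReducesTo.exists_quasiIsometry`). Conversely, a quasi-isometry `O → Y` transports the quasi-action
to `Y` (`exists_reducesTo_of_quasiIsometry`). So the question is when `O` is quasi-isometric to a
bounded valence tree.

Such a tree is coarse connected, and its vertex set is a proper space quasi-isometric to it, so the
three conditions are necessary.

For sufficiency, take a maximal separated set `S` in `O` and its image under a map `φ` of `O` to the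
vertices of a tree. The union of the geodesics from a base vertex to `φ '' S` is a subtree. By
coarse connectedness every vertex `v` of it has a point of `φ '' S` beyond it at bounded distance: a
chain leading to a point beyond `v` must jump across `v`, and its jumps are bounded. Hence the
subtree is quasi-isometric to `O`. Its valence is bounded because the children of a vertex choose
distinct points of `S` in a set of bounded diameter, and such sets have bounded size
(`boundedGeometry_quasiOrbit`): the quasi-action moves every ball of `O` to a fixed one, which a
proper space controls.

If `α` is cobounded, the image of a reduction map is coarse dense, so reduction and equivalence
agree (`ReducesTo.equivalentTo`). -/

namespace SimpleGraph

/-! ### Geodesics and hulls in combinatorial trees -/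

variable {V : Type*} {G : SimpleGraph V}

/-- `w` lies on a geodesic from `a` to `b`. -/
def Between (G : SimpleGraph V) (a w b : V) : Prop :=
  G.dist a w + G.dist w b = G.dist a b

theorem Between.right (G : SimpleGraph V) (a b : V) : G.Between a b b := by
  simp [Between]

theorem Between.left (G : SimpleGraph V) (a b : V) : G.Between a a b := by
  simp [Between]

theorem Between.trans (hG : G.Connected) {a v w b : V} (h₁ : G.Between a v w)
    (h₂ : G.Between a w b) : G.Between a v b := by
  unfold Between at *
  have := hG.dist_triangle (u := a) (v := v) (w := b)
  have := hG.dist_triangle (u := v) (v := w) (w := b)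
  omega

theorem between_of_mem_support (hG : G.Connected) {a v b : V} (p : G.Walk a b)
    (hp : p.length = G.dist a b) (hv : v ∈ p.support) : G.Between a v b := by
  classical
  have h₁ := dist_le (p.takeUntil v hv)
  have h₂ := dist_le (p.dropUntil v hv)
  have h₃ := hG.dist_triangle (u := a) (v := v) (w := b)
  have h₄ := congrArg Walk.length (p.take_spec hv)
  rw [Walk.length_append] at h₄
  unfold Between
  omega

theorem IsTree.eq_of_length_eq_dist (hG : G.IsTree) {a b : V} {p q : G.Walk a b}
    (hp : p.length = G.dist a b) (hq : q.length = G.dist a b) : p = q :=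
  (hG.existsUnique_path a b).unique (p.isPath_of_length_eq_dist hp) (q.isPath_of_length_eq_dist hq)

/-- The points of a geodesic are determined by their distance from its origin. -/
theorem IsTree.eq_of_between (hG : G.IsTree) {a b v w : V} (hv : G.Between a v b)
    (hw : G.Between a w b) (h : G.dist a v = G.dist a w) : v = w := by
  have key : ∀ x, G.Between a x b → ∃ p : G.Walk a b,
      p.length = G.dist a b ∧ p.getVert (G.dist a x) = x := by
    intro x hx
    obtain ⟨p, hp⟩ := hG.connected.exists_walk_length_eq_dist a x
    obtain ⟨q, hq⟩ := hG.connected.exists_walk_length_eq_dist x b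
    refine ⟨p.append q, by rw [Walk.length_append, hp, hq, hx], ?_⟩
    rw [← hp, Walk.getVert_append]
    simp
  obtain ⟨p, hp, hp'⟩ := key v hv
  obtain ⟨q, hq, hq'⟩ := key w hw
  rw [← hp', ← hq', hG.eq_of_length_eq_dist hp hq, h]

/-- An edge that enters the set of descendants of `w` ends in `w`. -/
theorem IsTree.eq_of_adj_of_between (hG : G.IsTree) {a w x y : V} (hxy : G.Adj x y)
    (hx : ¬ G.Between a w x) (hy : G.Between a w y) : y = w := by
  have h1 : G.dist x y = 1 := dist_eq_one_iff_adj.2 hxy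
  have hd := hG.dist_eq_dist_add_one_of_adj a hxy
  -- Root the tree at `a`. If `y ≠ w`, the vertex before `y` on a geodesic from `w` is a descendant
  -- of `w` and the parent of `y`. Now `x` is either a child of `y`, hence a descendant of `w`, or
  -- that same parent; both contradict `hx`.
  by_contra hne
  obtain ⟨p, hp⟩ := hG.connected.exists_walk_length_eq_dist w y
  have hpos : 0 < G.dist w y := hG.connected.pos_dist_of_ne (Ne.symm hne)
  have hnil : ¬ p.Nil := by
    rw [← Walk.length_eq_zero_iff]
    omega
  have hadj := p.adj_penultimate hnil
  have h2 : G.dist p.penultimate y = 1 := dist_eq_one_iff_adj.2 hadj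
  have h3 := between_of_mem_support hG.connected p hp (p.getVert_mem_support (p.length - 1))
  change G.Between w p.penultimate y at h3
  have t1 := hG.connected.dist_triangle (u := a) (v := w) (w := p.penultimate)
  have t2 := hG.connected.dist_triangle (u := a) (v := p.penultimate) (w := y)
  have t3 := hG.connected.dist_triangle (u := a) (v := w) (w := x)
  have t4 := hG.connected.dist_triangle (u := w) (v := y) (w := x)
  rw [dist_comm (u := y)] at t4
  unfold Between at *
  rcases hd with hd | hd
  · omega
  · have hxp : x = p.penultimate := hG.eq_of_between (b := y) (a := a)
      (by unfold Between; omega) (by unfold Between; omega) (by omega)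
    rw [hxp] at hx
    omega

/-- The first vertex of the walk that is a descendant of `w` is `w` itself: `w` separates its
descendants from the rest of the tree. -/
theorem IsTree.mem_support_of_between (hG : G.IsTree) {a w x y : V} (p : G.Walk x y)
    (hx : ¬ G.Between a w x) (hy : G.Between a w y) : w ∈ p.support := by
  induction p with
  | nil => exact absurd hy hx
  | @cons x z y hxz p ih =>
    rw [Walk.support_cons]
    refine List.mem_cons_of_mem _ ?_
    by_cases hz : G.Between a w z
    · rw [← hG.eq_of_adj_of_between hxz hx hz]
      exact p.start_mem_support
    · exact ih hz hy

theorem IsTree.dist_le_of_between (hG : G.IsTree) {a w x y : V}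
    (hx : ¬ G.Between a w x) (hy : G.Between a w y) : G.dist w y ≤ G.dist x y := by
  obtain ⟨p, hp⟩ := hG.connected.exists_walk_length_eq_dist x y
  have := between_of_mem_support hG.connected p hp (hG.mem_support_of_between p hx hy)
  unfold Between at this
  omega

/-- A shortest path in the subgraph is still a path in the tree, where paths are unique and
therefore shortest. -/
theorem IsTree.dist_induce (hG : G.IsTree) {H : Set V} (hH : (G.induce H).Connected) (x y : H) :
    (G.induce H).dist x y = G.dist x y := by
  obtain ⟨p, hp, hl⟩ := hH.exists_path_of_dist x y
  obtain ⟨q, hq, hl'⟩ := hG.connected.exists_path_of_dist (x : V) y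
  let f : G.induce H ↪g G := Embedding.induce H
  have := (hG.existsUnique_path (x : V) y).unique
    (hp.map (f := f.toHom) f.injective) hq
  rw [← hl, ← hl', ← this]
  exact (Walk.length_map _ _).symm

/-- The union of the geodesics from `a` to the points of `S`. -/
def starHull (G : SimpleGraph V) (a : V) (S : Set V) : Set V :=
  {v | ∃ s ∈ S, G.Between a v s}

theorem subset_starHull (G : SimpleGraph V) (a : V) (S : Set V) : S ⊆ G.starHull a S :=
  fun s hs => ⟨s, hs, Between.right G a s⟩

theorem induce_starHull_connected (hG : G.Connected) {a : V} {S : Set V} (hS : S.Nonempty) :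
    (G.induce (G.starHull a S)).Connected := by
  obtain ⟨s₀, hs₀⟩ := hS
  have ha : a ∈ G.starHull a S := ⟨s₀, hs₀, Between.left G a s₀⟩
  rw [connected_iff_exists_forall_reachable]
  refine ⟨⟨a, ha⟩, ?_⟩
  rintro ⟨v, s, hs, hv⟩
  obtain ⟨p, hp⟩ := hG.exists_walk_length_eq_dist a v
  exact (p.induce (G.starHull a S) fun x hx =>
    ⟨s, hs, (between_of_mem_support hG p hp hx).trans hG hv⟩).reachable

end SimpleGraph

namespace CoarseGeom

/-! ### Quasi-isometries and separated sets -/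

section QuasiIsometry

variable {X Y Z : Type*} [MetricSpace X] [MetricSpace Y] [MetricSpace Z]

theorem QIEmbeddingWith.dist_le {K ε : ℝ} {q : X → Y} (hK : 1 ≤ K) (h : QIEmbeddingWith K ε q)
    (x y : X) : dist x y ≤ K * dist (q x) (q y) + K * ε := by
  have h1 : dist x y ≤ K * (1 / K * dist x y) := by
    rw [← mul_assoc, mul_one_div_cancel (by positivity), one_mul]
  have h2 := mul_le_mul_of_nonneg_left (h x y).1 (by linarith : 0 ≤ K)
  linarith

theorem QIEmbeddingWith.of_le {K c : ℝ} {q : X → Y} (hK : 1 ≤ K) (hc : 0 ≤ c)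
    (h₁ : ∀ x y, dist (q x) (q y) ≤ K * dist x y + c)
    (h₂ : ∀ x y, dist x y ≤ K * dist (q x) (q y) + c) : QIEmbeddingWith K c q := by
  refine fun x y => ⟨?_, h₁ x y⟩
  have h := mul_le_mul_of_nonneg_left (h₂ x y) (by positivity : 0 ≤ 1 / K)
  have h' : 1 / K * (K * dist (q x) (q y) + c) = dist (q x) (q y) + 1 / K * c := by
    field_simp
  have h'' : 1 / K * c ≤ 1 * c := by
    gcongr
    rw [div_le_one (by linarith)]
    exact hK
  linarith

/-- A form symmetric in the two distances and free of division, so that later estimates are linear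
once products are supplied. -/
theorem isQIEmbedding_iff {q : X → Y} : IsQIEmbedding q ↔ ∃ K c : ℝ, 1 ≤ K ∧ 0 ≤ c ∧
    (∀ x y, dist (q x) (q y) ≤ K * dist x y + c) ∧
    ∀ x y, dist x y ≤ K * dist (q x) (q y) + c := by
  constructor
  · rintro ⟨K, ε, hK, hε, h⟩
    have h1 : ε ≤ K * ε := le_mul_of_one_le_left hε hK
    exact ⟨K, K * ε, hK, by positivity, fun x y => (h x y).2.trans (by linarith), h.dist_le hK⟩
  · rintro ⟨K, c, hK, hc, h₁, h₂⟩
    exact ⟨K, c, hK, hc, .of_le hK hc h₁ h₂⟩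

theorem isQuasiIsometry_iff {q : X → Y} :
    IsQuasiIsometry q ↔ IsQIEmbedding q ∧ CoarseDense (Set.range q) := by
  constructor
  · rintro ⟨K, ε, C, hK, hε, hC, h, hne, hd⟩
    refine ⟨⟨K, ε, hK, hε, h⟩, C + 1, by positivity, hne, fun y => ?_⟩
    obtain ⟨s, hs, hs'⟩ := hd y
    exact ⟨s, hs, by linarith⟩
  · rintro ⟨⟨K, ε, hK, hε, h⟩, C, hC, hd⟩
    exact ⟨K, ε, C, hK, hε, hC.le, h, hd⟩

theorem IsQIEmbedding.comp {p : Y → Z} {q : X → Y} (hp : IsQIEmbedding p)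
    (hq : IsQIEmbedding q) : IsQIEmbedding (p ∘ q) := by
  rw [isQIEmbedding_iff] at *
  obtain ⟨K, c, hK, hc, hp₁, hp₂⟩ := hp
  obtain ⟨L, e, hL, he, hq₁, hq₂⟩ := hq
  refine ⟨K * L, K * e + L * c + c + e, one_le_mul_of_one_le_of_one_le hK hL, by positivity,
    fun x y => ?_, fun x y => ?_⟩
  · have h1 := hp₁ (q x) (q y)
    have h2 := mul_le_mul_of_nonneg_left (hq₁ x y) (by linarith : 0 ≤ K)
    have : 0 ≤ L * c := by positivity
    simp only [Function.comp]
    linarith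
  · have h1 := hq₂ x y
    have h2 := mul_le_mul_of_nonneg_left (hp₂ (q x) (q y)) (by linarith : 0 ≤ L)
    have : 0 ≤ K * e := by positivity
    simp only [Function.comp]
    linarith

theorem isQIEmbedding_subtype_val (S : Set X) : IsQIEmbedding (Subtype.val : S → X) :=
  isQIEmbedding_iff.2 ⟨1, 0, le_rfl, le_rfl, fun x y => by simp [Subtype.dist_eq],
    fun x y => by simp [Subtype.dist_eq]⟩

theorem IsQuasiIsometry.exists_coarse_inverse {q : X → Y} (hq : IsQuasiIsometry q) :
    ∃ p : Y → X, IsQuasiIsometry p ∧ ∃ C : ℝ, 0 ≤ C ∧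
      (∀ y, dist (q (p y)) y ≤ C) ∧ ∀ x, dist (p (q x)) x ≤ C := by
  rw [isQuasiIsometry_iff, isQIEmbedding_iff] at hq
  obtain ⟨⟨K, c, hK, hc, h₁, h₂⟩, D, hD, hne, hd⟩ := hq
  have hd' : ∀ y, ∃ x, dist y (q x) ≤ D := fun y => by
    obtain ⟨_, ⟨x, rfl⟩, hx⟩ := hd y
    exact ⟨x, hx⟩
  choose p hp using hd'
  have hpq : ∀ x, dist (p (q x)) x ≤ K * D + c := fun x => by
    have := mul_le_mul_of_nonneg_left (hp (q x)) (by linarith : 0 ≤ K)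
    rw [dist_comm (q x)] at this
    exact (h₂ _ _).trans (by linarith)
  have hne' : Nonempty X := by
    obtain ⟨_, x, -⟩ := hne
    exact ⟨x⟩
  have hKD : D ≤ K * D := le_mul_of_one_le_left hD.le hK
  refine ⟨p, isQuasiIsometry_iff.2 ⟨isQIEmbedding_iff.2 ⟨K, K * (2 * D) + c, hK, by positivity,
    fun x y => ?_, fun x y => ?_⟩, K * D + c, by positivity, ?_, fun x => ?_⟩,
    K * D + c, by positivity, fun y => ?_, hpq⟩
  · have h3 := dist_triangle4_left x y (q (p x)) (q (p y))
    have h4 := dist_triangle4 (q (p x)) x y (q (p y))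
    have h5 := hp x
    have h6 := hp y
    rw [dist_comm] at h5
    have h7 := mul_le_mul_of_nonneg_left
      (by linarith : dist (q (p x)) (q (p y)) ≤ dist x y + 2 * D) (by linarith : 0 ≤ K)
    linarith [h₂ (p x) (p y)]
  · have h4 := dist_triangle4 x (q (p x)) (q (p y)) y
    have h5 := hp x
    have h6 := hp y
    rw [dist_comm] at h6
    linarith [h₁ (p x) (p y)]
  · obtain ⟨y, -⟩ := hne
    exact ⟨p y, y, rfl⟩
  · exact ⟨_, ⟨q x, rfl⟩, by rw [dist_comm]; exact hpq x⟩
  · rw [dist_comm]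
    linarith [hp y]

theorem CoarseConnected.of_quasiIsometry {q : X → Y} (hq : IsQuasiIsometry q)
    (hY : CoarseConnected Y) : CoarseConnected X := by
  obtain ⟨p, hp, C, hC, -, hpq⟩ := hq.exists_coarse_inverse
  obtain ⟨K, c, hK, hc, h₁, -⟩ := isQIEmbedding_iff.1 (isQuasiIsometry_iff.1 hp).1
  obtain ⟨e, he, h⟩ := hY
  -- `K * e + c` bounds the `p`-images of jumps of length `e`; `C` covers the end steps between a
  -- point and its image under `p ∘ q`.
  refine ⟨K * e + c + C, by positivity, fun x y => ?_⟩
  have hKe : 0 ≤ K * e := by positivity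
  have step : ∀ x, dist (p (q x)) x ≤ K * e + c + C := fun x => (hpq x).trans (by linarith)
  refine Relation.ReflTransGen.head (b := p (q x)) (by rw [dist_comm]; exact step x)
    (Relation.ReflTransGen.tail (b := p (q y)) ?_ (step y))
  refine (h (q x) (q y)).lift p fun a b hab => ?_
  have := mul_le_mul_of_nonneg_left hab (by linarith : 0 ≤ K)
  have := h₁ a b
  change dist (p a) (p b) ≤ _
  linarith

/-- There is a maximal set of points with distances greater than `r`. -/
theorem exists_maximal_separated (X : Type*) [MetricSpace X] (r : ℝ) :
    ∃ S : Set X, S.Pairwise (fun x y => r < dist x y) ∧ ∀ x, ∃ s ∈ S, dist x s ≤ max r 0 := by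
  obtain ⟨S, hS⟩ := zorn_subset {S : Set X | S.Pairwise fun x y => r < dist x y} (by
    intro c hc hchain
    refine ⟨⋃₀ c, ?_, fun s hs => Set.subset_sUnion_of_mem hs⟩
    exact (Set.pairwise_sUnion hchain.directedOn).2 hc)
  refine ⟨S, hS.prop, fun x => ?_⟩
  -- A point further than `max r 0` from all of `S` could be added to `S`. The `0` ensures that the
  -- point is not already in `S` when `r` is negative.
  by_contra! hx
  have hxS : x ∉ S := fun h => by
    have := hx x h
    rw [dist_self] at this
    exact absurd this (not_lt.2 (le_max_right _ _))
  refine hxS (hS.le_of_ge (y := insert x S) ?_ (Set.subset_insert x S) (Set.mem_insert x S))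
  have key : ∀ b ∈ S, r < dist x b := fun b hb => (le_max_left _ _).trans_lt (hx b hb)
  exact hS.prop.insert fun b hb _ => ⟨key b hb, by rw [dist_comm]; exact key b hb⟩

end QuasiIsometry

/-! ### Quasi-actions, reduction and equivalence -/

section QuasiAction

variable {G X Y : Type*} [Group G] [MetricSpace X] [MetricSpace Y]

/-- The constants of a quasi-action, in the form used below. -/
theorem IsQuasiAction.exists_bounds {α : G → X → X} (hα : IsQuasiAction α) :
    ∃ K C : ℝ, 1 ≤ K ∧ 0 ≤ C ∧ (∀ g x y, dist (α g x) (α g y) ≤ K * dist x y + C) ∧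
      (∀ g x y, dist x y ≤ K * dist (α g x) (α g y) + C) ∧ (∀ x, dist (α 1 x) x ≤ C) ∧
      ∀ g h x, dist (α g (α h x)) (α (g * h) x) ≤ C := by
  obtain ⟨K, ε, C, hK, hε, hC, h⟩ := hα
  have h1 : ε ≤ K * ε := le_mul_of_one_le_left hε hK
  refine ⟨K, K * ε + C, hK, by positivity, fun g x y => ?_, fun g x y => ?_, fun x => ?_,
    fun g k x => ?_⟩
  · linarith [((h.quasiIsometry g).1 x y).2]
  · linarith [(h.quasiIsometry g).1.dist_le hK x y]
  · linarith [h.one x]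
  · linarith [h.mul x g k]

/-- Coarse surjectivity of `α g` is automatic: `α g (α g⁻¹ x)` is within `C` of `α 1 x`, hence
within `2 * C` of `x`. -/
theorem IsQuasiAction.of_bounds {α : G → X → X} [Nonempty X] {K C : ℝ} (hK : 1 ≤ K) (hC : 0 ≤ C)
    (h₁ : ∀ g x y, dist (α g x) (α g y) ≤ K * dist x y + C)
    (h₂ : ∀ g x y, dist x y ≤ K * dist (α g x) (α g y) + C)
    (h₃ : ∀ x, dist (α 1 x) x ≤ C)
    (h₄ : ∀ g h x, dist (α g (α h x)) (α (g * h) x) ≤ C) : IsQuasiAction α := by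
  refine ⟨K, C, 2 * C, hK, hC, by positivity, fun g => ⟨.of_le hK hC (h₁ g) (h₂ g),
    Set.range_nonempty _, fun x => ⟨_, ⟨α g⁻¹ x, rfl⟩, ?_⟩⟩, fun x => ?_, fun x g h => ?_⟩
  · have h5 := h₄ g g⁻¹ x
    rw [mul_inv_cancel] at h5
    rw [dist_comm]
    linarith [dist_triangle (α g (α g⁻¹ x)) (α 1 x) x, h₃ x]
  · linarith [h₃ x]
  · linarith [h₄ g h x]

/-- A family of maps that corresponds to a quasi-action under a coarse equivariant
quasi-isometric embedding is a quasi-action. -/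
theorem IsQuasiAction.of_coarseEquivariant [Nonempty Y] {α : G → X → X} (hα : IsQuasiAction α)
    {β : G → Y → Y} {F : Y → X} (hF : IsQIEmbedding F) (hF' : CoarseEquivariant β α F) :
    IsQuasiAction β := by
  obtain ⟨K, C, hK, hC, a₁, a₂, a₃, a₄⟩ := hα.exists_bounds
  obtain ⟨L, e, hL, he, f₁, f₂⟩ := isQIEmbedding_iff.1 hF
  obtain ⟨M, hM, hE⟩ := hF'
  have hL0 : 0 ≤ L := by linarith
  have hK0 : 0 ≤ K := by linarith
  have e' : ∀ g y, dist (α g (F y)) (F (β g y)) ≤ M := fun g y => by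
    rw [dist_comm]; exact hE y g
  have D₁ : 0 ≤ L * (K * e + C + 2 * M) + e := by positivity
  have D₂ : 0 ≤ L * (K * (e + 2 * M) + C) + e := by positivity
  have D₃ : 0 ≤ L * (M + C) + e := by positivity
  have D₄ : 0 ≤ L * (K * M + 2 * C + 2 * M + C) + e := by positivity
  -- The additive constant is the sum of the errors in the four axioms, each non-negative, so each
  -- axiom can discard the other three.
  refine .of_bounds (K := L * K * L) (C := (L * (K * e + C + 2 * M) + e) +
    (L * (K * (e + 2 * M) + C) + e) + (L * (M + C) + e) + (L * (K * M + 2 * C + 2 * M + C) + e))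
    (one_le_mul_of_one_le_of_one_le (one_le_mul_of_one_le_of_one_le hL hK) hL)
    (by positivity) (fun g x y => ?_) (fun g x y => ?_) (fun x => ?_) (fun g h x => ?_)
  · have s1 := f₂ (β g x) (β g y)
    have s2 := dist_triangle4 (F (β g x)) (α g (F x)) (α g (F y)) (F (β g y))
    have s3 := a₁ g (F x) (F y)
    have s4 := mul_le_mul_of_nonneg_left (f₁ x y) hK0
    have s5 : dist (F (β g x)) (F (β g y)) ≤ K * (L * dist x y + e) + C + 2 * M := by
      linarith [e' g y, hE x g]
    have s6 := mul_le_mul_of_nonneg_left s5 hL0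
    linarith
  · have s1 := f₂ x y
    have s2 := a₂ g (F x) (F y)
    have s3 := dist_triangle4 (α g (F x)) (F (β g x)) (F (β g y)) (α g (F y))
    have s4 : dist (α g (F x)) (α g (F y)) ≤ L * dist (β g x) (β g y) + e + 2 * M := by
      linarith [e' g x, hE y g, f₁ (β g x) (β g y)]
    have s5 := mul_le_mul_of_nonneg_left s4 hK0
    have s6 := mul_le_mul_of_nonneg_left (s2.trans (by linarith : _ ≤
      K * (L * dist (β g x) (β g y) + e + 2 * M) + C)) hL0
    linarith
  · have s1 := f₂ (β 1 x) x
    have s2 := dist_triangle (F (β 1 x)) (α 1 (F x)) (F x)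
    have s3 := mul_le_mul_of_nonneg_left (s2.trans (add_le_add (hE x 1) (a₃ (F x)))) hL0
    linarith
  · have s1 := f₂ (β g (β h x)) (β (g * h) x)
    have s2 := dist_triangle4 (F (β g (β h x))) (α g (F (β h x))) (α g (α h (F x)))
      (F (β (g * h) x))
    have s3 := dist_triangle (α g (α h (F x))) (α (g * h) (F x)) (F (β (g * h) x))
    have s4 := a₁ g (F (β h x)) (α h (F x))
    have s5 := mul_le_mul_of_nonneg_left (hE x h) hK0
    have s6 : dist (F (β g (β h x))) (F (β (g * h) x)) ≤ K * M + 2 * C + 2 * M + C := by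
      linarith [hE (β h x) g, a₄ g h (F x), e' (g * h) x]
    have s7 := mul_le_mul_of_nonneg_left s6 hL0
    linarith

theorem CoarseEquivariant.coarse_inverse {α : G → X → X} {β : G → Y → Y} (hβ : IsQuasiAction β)
    {F : X → Y} (hF : IsQIEmbedding F) (hF' : CoarseEquivariant α β F) {E : Y → X} {C : ℝ}
    (hE : ∀ y, dist (F (E y)) y ≤ C) : CoarseEquivariant β α E := by
  obtain ⟨K, D, hK, hD, b₁, -, -, -⟩ := hβ.exists_bounds
  obtain ⟨L, e, hL, he, -, f₂⟩ := isQIEmbedding_iff.1 hF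
  obtain ⟨M, hM, hM'⟩ := hF'
  have key : ∀ y g, dist (E (β g y)) (α g (E y)) ≤ L * (C + (K * C + D) + M) + e := by
    intro y g
    refine (f₂ _ _).trans ?_
    gcongr
    have s1 := dist_triangle4 (F (E (β g y))) (β g y) (β g (F (E y))) (F (α g (E y)))
    have s2 := b₁ g y (F (E y))
    have s3 := mul_le_mul_of_nonneg_left (hE y) (by linarith : 0 ≤ K)
    have s4 := hM' (E y) g
    rw [dist_comm] at s4
    rw [dist_comm (F (E y))] at s3
    linarith [hE (β g y)]
  refine ⟨max 0 (L * (C + (K * C + D) + M) + e), le_max_left _ _, fun y g =>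
    (key y g).trans (le_max_right _ _)⟩

theorem EquivalentTo.symm {α : G → X → X} {β : G → Y → Y} (hβ : IsQuasiAction β)
    (h : EquivalentTo α β) : EquivalentTo β α := by
  obtain ⟨F, hF, hF'⟩ := h
  obtain ⟨E, hE, C, -, hFE, -⟩ := hF.exists_coarse_inverse
  exact ⟨E, hE, hF'.coarse_inverse hβ (isQuasiIsometry_iff.1 hF).1 hFE⟩

theorem EquivalentTo.reducesTo {α : G → X → X} {β : G → Y → Y} (hβ : IsQuasiAction β)
    (h : EquivalentTo α β) : ReducesTo α β := by
  obtain ⟨E, hE, hE'⟩ := h.symm hβ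
  exact ⟨E, (isQuasiIsometry_iff.1 hE).1, hE'⟩

theorem Cobounded.coarseDense_quasiOrbit {α : G → X → X} (hα : IsQuasiAction α)
    (h : Cobounded α) (x : X) : CoarseDense (quasiOrbit α x) := by
  obtain ⟨K, C, hK, hC, a₁, -, -, -⟩ := hα.exists_bounds
  obtain ⟨x₁, D, hD, -, h⟩ := h
  have : 0 ≤ K * dist x₁ x := mul_nonneg (by linarith) dist_nonneg
  refine ⟨D + (K * dist x₁ x + C), by positivity, ⟨_, 1, rfl⟩, fun y => ?_⟩
  obtain ⟨_, ⟨g, rfl⟩, hg⟩ := h y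
  refine ⟨α g x, ⟨g, rfl⟩, ?_⟩
  have := dist_triangle y (α g x₁) (α g x)
  dsimp only at hg
  linarith [a₁ g x₁ x]

/-- The image of the reduction map follows the quasi-orbit of `F y` up to the equivariance error,
and that quasi-orbit is coarse dense whatever the base point. -/
theorem ReducesTo.equivalentTo [Nonempty Y] {α : G → X → X} {β : G → Y → Y} (hα : IsQuasiAction α)
    (hα' : Cobounded α) (h : ReducesTo α β) : EquivalentTo α β := by
  obtain ⟨F, hF, hF'⟩ := h
  refine EquivalentTo.symm hα ⟨F, isQuasiIsometry_iff.2 ⟨hF, ?_⟩, hF'⟩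
  obtain ⟨y⟩ := ‹Nonempty Y›
  obtain ⟨D, hD, -, h⟩ := hα'.coarseDense_quasiOrbit hα (F y)
  obtain ⟨M, hM, hM'⟩ := hF'
  refine ⟨D + M, by positivity, ⟨_, y, rfl⟩, fun x => ?_⟩
  obtain ⟨_, ⟨g, rfl⟩, hg⟩ := h x
  refine ⟨F (β g y), ⟨_, rfl⟩, ?_⟩
  have := dist_triangle_right x (F (β g y)) (α g (F y))
  dsimp only at hg
  linarith [hM' y g]

end QuasiAction

end CoarseGeom

namespace CoarseGeom

theorem IsQuasiIsometry.comp {X Y Z : Type*} [MetricSpace X] [MetricSpace Y] [MetricSpace Z]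
    {p : Y → Z} {q : X → Y} (hp : IsQuasiIsometry p) (hq : IsQuasiIsometry q) :
    IsQuasiIsometry (p ∘ q) := by
  rw [isQuasiIsometry_iff] at *
  refine ⟨hp.1.comp hq.1, ?_⟩
  obtain ⟨C, hC, -, hC'⟩ := hp.2
  obtain ⟨D, hD, ⟨_, x₀, -⟩, hD'⟩ := hq.2
  obtain ⟨K, c, hK, hc, h₁, -⟩ := isQIEmbedding_iff.1 hp.1
  refine ⟨C + (K * D + c), by positivity, ⟨_, x₀, rfl⟩, fun z => ?_⟩
  obtain ⟨_, ⟨y, rfl⟩, hy⟩ := hC' z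
  obtain ⟨_, ⟨x, rfl⟩, hx⟩ := hD' y
  refine ⟨_, ⟨x, rfl⟩, ?_⟩
  have h2 := mul_le_mul_of_nonneg_left hx (by linarith : 0 ≤ K)
  have h3 := dist_triangle z (p y) (p (q x))
  simp only [Function.comp]
  linarith [h₁ y (q x)]

/-! ### Vertex sets of trees as models of their realizations -/

namespace SimplicialTree

/-- The graph metric on the vertices of `T`. -/
noncomputable instance (T : SimplicialTree) : MetricSpace T.Vertex where
  dist u v := T.graph.dist u v
  dist_self _ := by simp
  dist_comm _ _ := by rw [SimpleGraph.dist_comm]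
  dist_triangle _ _ _ := by exact_mod_cast T.isTree.connected.dist_triangle
  eq_of_dist_eq_zero h := T.isTree.connected.dist_eq_zero_iff.1 (by exact_mod_cast h)

theorem vertex_dist_eq {T : SimplicialTree} (u v : T.Vertex) :
    dist u v = (T.graph.dist u v : ℝ) := rfl

instance (T : SimplicialTree) : Nonempty T.Vertex := T.isTree.connected.nonempty

/-- Closed balls are finite, by induction on the radius: a vertex at distance `n + 1` is a neighbor
of one at distance `n`. -/
theorem BoundedValence.properSpace {T : SimplicialTree} (hT : T.BoundedValence) :
    ProperSpace T.Vertex := by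
  obtain ⟨N, hN⟩ := hT
  have hfin : ∀ (v : T.Vertex) (n : ℕ), {u | T.graph.dist v u ≤ n}.Finite := by
    intro v n
    induction n with
    | zero =>
      refine (Set.finite_singleton v).subset fun u hu => ?_
      exact (T.isTree.connected.dist_eq_zero_iff.1 (Nat.le_zero.1 hu)).symm
    | succ n ih =>
      refine (ih.union (ih.biUnion fun u _ =>
        Set.finite_of_encard_le_coe (hN u))).subset fun u hu => ?_
      obtain ⟨p, hp⟩ := T.isTree.connected.exists_walk_length_eq_dist v u
      by_cases hnil : p.Nil
      · left
        change T.graph.dist v u ≤ n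
        rw [← hp, hnil.length_eq_zero]
        exact Nat.zero_le _
      · right
        refine Set.mem_biUnion (x := p.penultimate) ?_ (p.adj_penultimate hnil)
        have h1 : T.graph.dist p.penultimate u = 1 :=
          SimpleGraph.dist_eq_one_iff_adj.2 (p.adj_penultimate hnil)
        have h2 := SimpleGraph.between_of_mem_support T.isTree.connected p hp
          (p.getVert_mem_support (p.length - 1))
        change T.graph.Between v p.penultimate u at h2
        unfold SimpleGraph.Between at h2
        change T.graph.dist v u ≤ n + 1 at hu
        change T.graph.dist v p.penultimate ≤ n
        omega
  refine ⟨fun v r => Set.Finite.isCompact ((hfin v ⌈r⌉₊).subset fun u hu => ?_)⟩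
  rw [Metric.mem_closedBall, dist_comm, vertex_dist_eq] at hu
  have := hu.trans (Nat.le_ceil r)
  exact_mod_cast this

/-- The subtree spanned by a set of vertices. -/
def induce (T : SimplicialTree) (H : Set T.Vertex) (hH : (T.graph.induce H).Connected) :
    SimplicialTree :=
  ⟨H, T.graph.induce H, hH, T.isTree.isAcyclic.induce H⟩

theorem dist_induce (T : SimplicialTree) (H : Set T.Vertex) (hH : (T.graph.induce H).Connected)
    (x y : H) : dist (show (T.induce H hH).Vertex from x) (show (T.induce H hH).Vertex from y) =
      dist (x : T.Vertex) y := by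
  rw [vertex_dist_eq, vertex_dist_eq, ← T.isTree.dist_induce hH]
  rfl

/-- The vertex `v` as a point of the geometric realization. -/
noncomputable def vertexPoint (T : SimplicialTree) (v : T.Vertex) : T.Realization where
  coord := Finsupp.single v 1
  nonneg u := by
    classical
    rw [Finsupp.single_apply]
    split_ifs <;> norm_num
  sum_eq_one := by simp
  inSimplex := ⟨v, v, Or.inl rfl, by
    refine (Finset.coe_subset.2 Finsupp.support_single_subset).trans ?_
    simp⟩

theorem vertexPoint_coord_self (T : SimplicialTree) (v : T.Vertex) :
    (T.vertexPoint v).coord v = 1 := Finsupp.single_eq_same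

theorem vertexPoint_support (T : SimplicialTree) (v : T.Vertex) :
    (T.vertexPoint v).coord.support = {v} :=
  Finsupp.support_single v one_ne_zero

theorem dist_vertexPoint (T : SimplicialTree) (u v : T.Vertex) :
    dist (T.vertexPoint u) (T.vertexPoint v) = dist u v := by
  classical
  have hvia : Realization.viaVertices (T.vertexPoint u) (T.vertexPoint v) = T.graph.dist u v := by
    obtain ⟨x, hx, y, hy, h⟩ :=
      Realization.exists_viaVertices_eq (T.vertexPoint u) (T.vertexPoint v)
    rw [vertexPoint_support, Finset.mem_singleton] at hx hy
    rw [h, hx, hy, vertexPoint_coord_self, vertexPoint_coord_self]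
    ring
  rw [vertex_dist_eq, ← hvia]
  change Realization.pathDist _ _ = _
  unfold Realization.pathDist
  split_ifs with h
  · exact le_antisymm (Realization.segLength_le_viaVertices h)
      (Realization.viaVertices_le_segLength h (vertexPoint_coord_self T u))
  · rfl

theorem exists_dist_vertexPoint_le (T : SimplicialTree) (b : T.Realization) :
    ∃ v : T.Vertex, dist b (T.vertexPoint v) ≤ 1 := by
  classical
  obtain ⟨v, hv⟩ := b.support_nonempty
  refine ⟨v, ?_⟩
  have hs : Realization.SameEdge b (T.vertexPoint v) := by
    unfold Realization.SameEdge
    rw [vertexPoint_support, Finset.coe_singleton,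
      Set.union_eq_self_of_subset_right (Set.singleton_subset_iff.2 hv)]
    exact b.inSimplex
  change Realization.pathDist _ _ ≤ 1
  unfold Realization.pathDist
  rw [if_pos hs]
  refine (Realization.segLength_le_viaVertices hs).trans ((Realization.viaVertices_le hv
    (v := v) (by rw [vertexPoint_support]; exact Finset.mem_singleton_self v)).trans ?_)
  rw [vertexPoint_coord_self, SimpleGraph.dist_self]
  have := b.nonneg v
  push_cast
  linarith

theorem isQuasiIsometry_vertexPoint (T : SimplicialTree) : IsQuasiIsometry T.vertexPoint := by
  refine isQuasiIsometry_iff.2 ⟨isQIEmbedding_iff.2 ⟨1, 0, le_rfl, le_rfl,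
    fun x y => by rw [dist_vertexPoint]; linarith,
    fun x y => by rw [dist_vertexPoint]; linarith⟩, 1, one_pos, Set.range_nonempty _, fun b => ?_⟩
  obtain ⟨v, hv⟩ := T.exists_dist_vertexPoint_le b
  exact ⟨_, ⟨v, rfl⟩, hv⟩

theorem exists_isQuasiIsometry_vertex (T : SimplicialTree) :
    ∃ p : T.Realization → T.Vertex, IsQuasiIsometry p := by
  obtain ⟨p, hp, -⟩ := T.isQuasiIsometry_vertexPoint.exists_coarse_inverse
  exact ⟨p, hp⟩

theorem coarseConnected_vertex (T : SimplicialTree) : CoarseConnected T.Vertex := by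
  refine ⟨1, one_pos, fun x y => ?_⟩
  obtain ⟨p⟩ := T.isTree.connected.preconnected x y
  induction p with
  | nil => exact .refl
  | cons h _ ih =>
    refine .head ?_ ih
    rw [vertex_dist_eq, SimpleGraph.dist_eq_one_iff_adj.2 h, Nat.cast_one]

theorem coarseConnected_realization (T : SimplicialTree) : CoarseConnected T.Realization := by
  obtain ⟨p, hp⟩ := T.exists_isQuasiIsometry_vertex
  exact .of_quasiIsometry hp T.coarseConnected_vertex

end SimplicialTree

/-! ### Pruning a tree to bounded valence -/

theorem exists_step_of_reflTransGen {A : Type*} {r : A → A → Prop} {D : A → Prop} {a b : A}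
    (h : Relation.ReflTransGen r a b) (ha : ¬ D a) (hb : D b) : ∃ x y, r x y ∧ ¬ D x ∧ D y := by
  induction h with
  | refl => exact absurd hb ha
  | @tail x y _ hxy ih =>
    by_cases hx : D x
    · exact ih hx
    · exact ⟨x, y, hxy, hx, hb⟩

/-- At some scale `r`, the size of an `r`-separated set is bounded in terms of its diameter. -/
def BoundedGeometry (A : Type*) [MetricSpace A] : Prop :=
  ∃ r : ℝ, 0 ≤ r ∧ ∀ R : ℝ, ∃ N : ℕ, ∀ s : Finset A,
    (s : Set A).Pairwise (fun x y => r < dist x y) → (∀ x ∈ s, ∀ y ∈ s, dist x y ≤ R) → s.card ≤ N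

theorem encard_le_of_forall_finset {A : Type*} {s : Set A} {N : ℕ}
    (h : ∀ t : Finset A, (t : Set A) ⊆ s → t.card ≤ N) : s.encard ≤ N := by
  by_contra! hlt
  obtain ⟨t, ht, hc⟩ := Set.exists_subset_encard_eq
    (show ((N + 1 : ℕ) : ℕ∞) ≤ s.encard by
      rw [Nat.cast_add, Nat.cast_one]; exact Order.add_one_le_of_lt hlt)
  have hfin : t.Finite := Set.finite_of_encard_eq_coe hc
  lift t to Finset A using hfin
  rw [Set.encard_coe_eq_coe_finsetCard] at hc
  have h1 := h t ht
  have h2 : t.card = N + 1 := by exact_mod_cast hc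
  omega

/-- The new tree is the hull of the image of a net in `A`. Coarse connectedness keeps the hull close
to that image, and bounded geometry limits its branching. -/
theorem BoundedGeometry.exists_boundedValence {A : Type*} [MetricSpace A] [Nonempty A]
    (hB : BoundedGeometry A) (hA : CoarseConnected A) {T : SimplicialTree.{w}}
    {q : A → T.Realization} (hq : IsQIEmbedding q) :
    ∃ T' : SimplicialTree.{w}, T'.BoundedValence ∧
      ∃ f : A → T'.Realization, IsQuasiIsometry f := by
  classical
  obtain ⟨p, hp⟩ := T.exists_isQuasiIsometry_vertex
  obtain ⟨K, c, hK, hc, h₁, h₂⟩ := isQIEmbedding_iff.1 ((isQuasiIsometry_iff.1 hp).1.comp hq)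
  set φ : A → T.Vertex := p ∘ q
  obtain ⟨r, hr, hB⟩ := hB
  obtain ⟨e, he, hA⟩ := hA
  obtain ⟨S, hS, hS'⟩ := exists_maximal_separated A r
  rw [max_eq_left hr] at hS'
  choose n hnS hn using hS'
  have hn' : ∀ x, dist (n x) x ≤ r := fun x => by rw [dist_comm]; exact hn x
  obtain ⟨a₀, ha₀⟩ : ∃ a, a ∈ S := ⟨n (Classical.arbitrary A), hnS _⟩
  have hn_self : ∀ a ∈ S, n a = a := fun a ha => by
    by_contra hne
    exact absurd (hS ha (hnS a) (Ne.symm hne)) (not_lt.2 (hn a))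
  -- The largest jump of `φ ∘ n` along a step of length `e` in `A`: rounding to the net adds at most
  -- `r` at each end.
  set J : ℝ := K * (e + 2 * r) + c with hJ
  have hJ0 : 0 ≤ J := by positivity
  set H : Set T.Vertex := T.graph.starHull (φ a₀) (φ '' S) with hH
  have near : ∀ v ∈ H, ∃ y ∈ S, T.graph.Between (φ a₀) v (φ y) ∧
      (T.graph.dist v (φ y) : ℝ) ≤ J := by
    rintro v ⟨_, ⟨s, hs, rfl⟩, hv⟩
    by_cases hva : v = φ a₀
    · refine ⟨a₀, ha₀, ?_, ?_⟩
      · rw [hva]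
        exact SimpleGraph.Between.left _ _ _
      · rw [hva, SimpleGraph.dist_self]
        simpa using hJ0
    -- A chain in `A` from `a₀` to `s` starts outside the descendants of `v` and ends among them. At
    -- the step that enters, the path in the tree passes through `v`, so `v` is within one jump of
    -- the entry point.
    · obtain ⟨x, y, hxy, hx, hy⟩ := exists_step_of_reflTransGen (hA a₀ s)
        (D := fun a => T.graph.Between (φ a₀) v (φ (n a))) (by
          rw [hn_self a₀ ha₀]
          intro h
          unfold SimpleGraph.Between at h
          rw [SimpleGraph.dist_self] at h
          exact hva (T.isTree.connected.dist_eq_zero_iff.1 (by omega : T.graph.dist (φ a₀) v = 0)).symm)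
        (by rwa [hn_self s hs])
      refine ⟨n y, hnS y, hy, ?_⟩
      have h3 : (T.graph.dist v (φ (n y)) : ℝ) ≤ T.graph.dist (φ (n x)) (φ (n y)) := by
        exact_mod_cast T.isTree.dist_le_of_between hx hy
      have h4 := h₁ (n x) (n y)
      rw [SimplicialTree.vertex_dist_eq] at h4
      have h5 := dist_triangle4 (n x) x y (n y)
      have h6 : dist (n x) (n y) ≤ e + 2 * r := by
        linarith [hn' x, hn y]
      have h7 := mul_le_mul_of_nonneg_left h6 (by linarith : 0 ≤ K)
      linarith
  have hconn : (T.graph.induce H).Connected :=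
    SimpleGraph.induce_starHull_connected T.isTree.connected ⟨φ a₀, a₀, ha₀, rfl⟩
  let T' : SimplicialTree.{w} := T.induce H hconn
  have hdist : ∀ x y : T'.Vertex, dist x y = (T.graph.dist x.1 y.1 : ℝ) := T.dist_induce H hconn
  refine ⟨T', ?_, ?_⟩
  -- Points of `S` chosen for two children of `v` map to within `J + 1` of `v`, so they are at most
  -- this far apart in `A`. The extra `1` in the valence bound is for the parent of `v`.
  · obtain ⟨N, hN⟩ := hB (K * (2 * (J + 1)) + c)
    refine ⟨N + 1, fun v => encard_le_of_forall_finset fun W hW => ?_⟩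
    have hadj : ∀ w ∈ W, T.graph.Adj v.1 w.1 := fun w hw => hW hw
    have hadj' : ∀ w ∈ W, T.graph.dist v.1 w.1 = 1 := fun w hw =>
      SimpleGraph.dist_eq_one_iff_adj.2 (hadj w hw)
    choose y hyS hy hyJ using fun w : T'.Vertex => near w.1 w.2
    rw [← Finset.card_filter_add_card_filter_not
      (fun w : T'.Vertex => T.graph.dist (φ a₀) w.1 = T.graph.dist (φ a₀) v.1 + 1)]
    refine add_le_add ?_ ?_
    · rw [← Finset.card_image_of_injOn (f := y)]
      · refine hN _ ?_ ?_
        · refine hS.mono ?_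
          intro a ha
          obtain ⟨w, -, rfl⟩ := Finset.mem_image.1 (Finset.mem_coe.1 ha)
          exact hyS w
        · have hv : ∀ a ∈ (W.filter fun w : T'.Vertex => T.graph.dist (φ a₀) w.1 =
              T.graph.dist (φ a₀) v.1 + 1).image y,
              dist (show T.Vertex from v.1) (φ a) ≤ J + 1 := by
            intro a ha
            obtain ⟨w, hw, rfl⟩ := Finset.mem_image.1 ha
            have h3 : (T.graph.dist v.1 (φ (y w)) : ℝ) ≤
                T.graph.dist v.1 w.1 + T.graph.dist w.1 (φ (y w)) := by
              exact_mod_cast T.isTree.connected.dist_triangle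
            rw [hadj' w (Finset.mem_filter.1 hw).1] at h3
            rw [SimplicialTree.vertex_dist_eq]
            have := hyJ w
            push_cast at h3
            linarith
          intro a ha b hb
          have h3 := dist_triangle_left (φ a) (φ b) (show T.Vertex from v.1)
          have h4 := mul_le_mul_of_nonneg_left (h3.trans (by linarith [hv a ha, hv b hb] :
            _ ≤ 2 * (J + 1))) (by linarith : 0 ≤ K)
          linarith [h₂ a b]
      -- Two children with the same chosen point lie on one geodesic from the root at the same
      -- depth, so they coincide.
      · intro w hw w' hw' hww
        have e1 := (Finset.mem_filter.1 (Finset.mem_coe.1 hw)).2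
        have e2 := (Finset.mem_filter.1 (Finset.mem_coe.1 hw')).2
        have b1 := hy w
        rw [hww] at b1
        exact Subtype.ext (T.isTree.eq_of_between b1 (hy w') (e1.trans e2.symm))
    · refine Finset.card_le_one.2 fun w hw w' hw' => ?_
      have parent : ∀ w ∈ W.filter fun w : T'.Vertex => ¬ T.graph.dist (φ a₀) w.1 =
          T.graph.dist (φ a₀) v.1 + 1, T.graph.dist (φ a₀) v.1 = T.graph.dist (φ a₀) w.1 + 1 := by
        intro w hw
        have h3 := T.isTree.dist_eq_dist_add_one_of_adj (φ a₀) (hadj w (Finset.mem_filter.1 hw).1)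
        have h4 := (Finset.mem_filter.1 hw).2
        omega
      have betw : ∀ w ∈ W.filter fun w : T'.Vertex => ¬ T.graph.dist (φ a₀) w.1 =
          T.graph.dist (φ a₀) v.1 + 1, T.graph.Between (φ a₀) w.1 v.1 := by
        intro w hw
        have h3 := hadj' w (Finset.mem_filter.1 hw).1
        rw [SimpleGraph.dist_comm] at h3
        unfold SimpleGraph.Between
        rw [h3, parent w hw]
      refine Subtype.ext (T.isTree.eq_of_between (betw w hw) (betw w' hw') ?_)
      have := parent w hw
      have := parent w' hw'
      omega
  · have hmem : ∀ a, φ (n a) ∈ H := fun a =>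
      SimpleGraph.subset_starHull _ _ _ ⟨n a, hnS a, rfl⟩
    let f : A → T'.Vertex := fun a => ⟨φ (n a), hmem a⟩
    have hfd : ∀ x y, dist (f x) (f y) = dist (φ (n x)) (φ (n y)) := fun x y => by
      rw [hdist]; rfl
    refine ⟨T'.vertexPoint ∘ f, T'.isQuasiIsometry_vertexPoint.comp (isQuasiIsometry_iff.2
      ⟨isQIEmbedding_iff.2 ⟨K, K * (2 * r) + c + 2 * r, hK, by positivity,
        fun x y => ?_, fun x y => ?_⟩, J + 1, by positivity, ⟨_, a₀, rfl⟩, fun v => ?_⟩)⟩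
    · have h5 := dist_triangle4 (n x) x y (n y)
      have h7 := mul_le_mul_of_nonneg_left (h5.trans (by linarith [hn' x, hn y] :
        _ ≤ dist x y + 2 * r)) (by linarith : 0 ≤ K)
      rw [hfd]
      linarith [h₁ (n x) (n y)]
    · have h5 := dist_triangle4 x (n x) (n y) y
      have : 0 ≤ K * (2 * r) := by positivity
      rw [hfd]
      linarith [h₂ (n x) (n y), hn x, hn' y]
    · obtain ⟨y, hyS, -, hy⟩ := near v.1 v.2
      refine ⟨f y, ⟨y, rfl⟩, ?_⟩
      rw [hdist]
      change (T.graph.dist v.1 (φ (n y)) : ℝ) ≤ _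
      rw [hn_self y hyS]
      linarith

end CoarseGeom

namespace CoarseGeom

/-! ### Geometry of quasi-orbits and transport of quasi-actions -/

section QuasiOrbit

variable {G X : Type*} [Group G] [MetricSpace X]

instance (α : G → X → X) (x : X) : Nonempty (quasiOrbit α x) := ⟨⟨_, 1, rfl⟩⟩

/-- If a quasi-orbit embeds in a proper space then it has bounded geometry, as every ball can be
moved to a fixed one. -/
theorem boundedGeometry_quasiOrbit {α : G → X → X} (hα : IsQuasiAction α) {x₀ : X}
    {Y : Type*} [MetricSpace Y] [ProperSpace Y] {p : quasiOrbit α x₀ → Y} (hp : IsQIEmbedding p) :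
    BoundedGeometry (quasiOrbit α x₀) := by
  classical
  obtain ⟨K, C, hK, hC, a₁, a₂, -, a₄⟩ := hα.exists_bounds
  obtain ⟨L, c, hL, hc, p₁, p₂⟩ := isQIEmbedding_iff.1 hp
  have hK0 : 0 ≤ K := by linarith
  have hL0 : 0 ≤ L := by linarith
  choose γ hγ using fun a : quasiOrbit α x₀ => a.2
  let o : G → quasiOrbit α x₀ := fun g => ⟨α g x₀, g, rfl⟩
  have ho : ∀ g (a : quasiOrbit α x₀), dist (α g a) (o (g * γ a) : X) ≤ C := fun g a => by
    conv_lhs => rw [← hγ a]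
    exact a₄ g (γ a) x₀
  have ho' : ∀ g (a : quasiOrbit α x₀), dist (o (g * γ a) : X) (α g a) ≤ C := fun g a => by
    rw [dist_comm]
    exact ho g a
  -- The separation scale: orbit points whose translates have `p`-images within `2` of each other
  -- are at most this far apart.
  refine ⟨K * (L * 2 + c + 2 * C) + C, by positivity, fun R => ?_⟩
  -- The ball is centered at the fixed point `p (o 1)`, so the size of the finite net `t` depends on
  -- `R` but not on the set `s`.
  obtain ⟨t, -, ht, ht'⟩ := (isCompact_closedBall (p (o 1)) (L * (K * R + 3 * C) + c)).totallyBounded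
    |> fun h => Metric.finite_approx_of_totallyBounded h 1 one_pos
  refine ⟨ht.toFinset.card, fun s hs hsR => ?_⟩
  rcases s.eq_empty_or_nonempty with rfl | ⟨a, ha⟩
  · simp
  -- Translation by `(γ a)⁻¹`, corrected by at most `C` to stay in the quasi-orbit and to send `a`
  -- exactly to `o 1`.
  let m : quasiOrbit α x₀ → quasiOrbit α x₀ := fun x => o ((γ a)⁻¹ * γ x)
  have hma : m a = o 1 := by simp only [m, inv_mul_cancel]
  have m₁ : ∀ x y, dist (m x) (m y) ≤ K * dist x y + 3 * C := fun x y => by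
    have h1 := dist_triangle4 (m x : X) (α (γ a)⁻¹ x) (α (γ a)⁻¹ y) (m y)
    rw [Subtype.dist_eq, Subtype.dist_eq]
    linarith [ho' (γ a)⁻¹ x, ho (γ a)⁻¹ y, a₁ (γ a)⁻¹ x y]
  have m₂ : ∀ x y, dist x y ≤ K * (dist (m x) (m y) + 2 * C) + C := fun x y => by
    have h1 := dist_triangle4 (α (γ a)⁻¹ x) (m x : X) (m y) (α (γ a)⁻¹ y)
    have h2 := mul_le_mul_of_nonneg_left (h1.trans (by linarith [ho (γ a)⁻¹ x, ho' (γ a)⁻¹ y] :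
      _ ≤ dist (m x : X) (m y) + 2 * C)) hK0
    rw [Subtype.dist_eq, Subtype.dist_eq]
    linarith [a₂ (γ a)⁻¹ x y]
  have cov : ∀ x ∈ s, ∃ z ∈ t, dist (p (m x)) z < 1 := fun x hx => by
    have h1 := mul_le_mul_of_nonneg_left (hsR x hx a ha) hK0
    have h2 := mul_le_mul_of_nonneg_left ((m₁ x a).trans (by linarith : _ ≤ K * R + 3 * C)) hL0
    rw [hma] at h2
    have h3 := ht' (Metric.mem_closedBall.2 ((p₁ (m x) (o 1)).trans (by linarith)))
    simpa using h3
  have : Nonempty Y := ⟨p (o 1)⟩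
  choose! z hzt hz using cov
  refine Finset.card_le_card_of_injOn z (fun x hx => ht.mem_toFinset.2 (hzt x hx)) ?_
  intro x hx y hy hxy
  by_contra hne
  have h1 := hz x hx
  have h2 := hz y hy
  rw [← hxy, dist_comm] at h2
  have h3 : dist (p (m x)) (p (m y)) ≤ 2 := by
    rw [dist_comm] at h2
    linarith [dist_triangle_right (p (m x)) (p (m y)) (z x)]
  have h4 := mul_le_mul_of_nonneg_left h3 hL0
  have h5 := mul_le_mul_of_nonneg_left (by linarith [p₂ (m x) (m y)] :
    dist (m x) (m y) + 2 * C ≤ L * 2 + c + 2 * C) hK0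
  have := hs hx hy hne
  linarith [m₂ x y]

/-- A space that is quasi-isometric to a quasi-orbit of `α` carries a cobounded quasi-action to
which `α` reduces. -/
theorem exists_reducesTo_of_quasiIsometry {α : G → X → X} (hα : IsQuasiAction α) {x₀ : X}
    {Y : Type*} [MetricSpace Y] {f : quasiOrbit α x₀ → Y} (hf : IsQuasiIsometry f) :
    ∃ β : G → Y → Y, IsQuasiAction β ∧ Cobounded β ∧ ReducesTo α β := by
  obtain ⟨p, hp, C, hC, -, hpf⟩ := hf.exists_coarse_inverse
  obtain ⟨-, D, -, hD, -, -, -, a₄⟩ := hα.exists_bounds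
  choose γ hγ using fun y : Y => (p y).2
  dsimp only at hγ
  -- Since `p y = α (γ y) x₀`, the point `α (g * γ y) x₀` is a substitute for `α g (p y)` that lies
  -- in the quasi-orbit, where `f` is defined.
  let β : G → Y → Y := fun g y => f ⟨α (g * γ y) x₀, _, rfl⟩
  have hβ : ∀ g y, dist (p (β g y) : X) (α (g * γ y) x₀) ≤ C := fun g y => hpf _
  have : Nonempty Y := ⟨f (Classical.arbitrary _)⟩
  have y₀ : Y := Classical.arbitrary Y
  have hF : IsQIEmbedding (Subtype.val ∘ p) :=
    (isQIEmbedding_subtype_val _).comp (isQuasiIsometry_iff.1 hp).1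
  have hF' : CoarseEquivariant β α (Subtype.val ∘ p) := by
    refine ⟨C + D, by positivity, fun y g => ?_⟩
    have h1 := a₄ g (γ y) x₀
    rw [hγ, dist_comm] at h1
    exact (dist_triangle _ _ _).trans (add_le_add (hβ g y) h1)
  refine ⟨β, hα.of_coarseEquivariant hF hF', ⟨y₀, ?_⟩, _, hF, hF'⟩
  obtain ⟨K, c, hK, hc, -, h₂⟩ := isQIEmbedding_iff.1 hF
  -- The element `γ y * (γ y₀)⁻¹` carries the orbit point `p y₀` to `p y`, so it moves `y₀` close to
  -- `y`.
  refine ⟨K * C + c + 1, by positivity, ⟨_, 1, rfl⟩, fun y => ⟨_, ⟨γ y * (γ y₀)⁻¹, rfl⟩, ?_⟩⟩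
  have h1 := hβ (γ y * (γ y₀)⁻¹) y₀
  rw [inv_mul_cancel_right, hγ, dist_comm] at h1
  have h2 := mul_le_mul_of_nonneg_left h1 (by linarith : 0 ≤ K)
  have h3 := h₂ y (β (γ y * (γ y₀)⁻¹) y₀)
  simp only [Function.comp] at h3
  linarith

/-- Both `F (β g y₀)` and `α g x₀` are near `α g (F y₀)`, uniformly in `g`. Hence the choice of `g`
representing an orbit point matters only up to bounded error. -/
theorem ReducesTo.exists_quasiIsometry {Y : Type*} [MetricSpace Y] {α : G → X → X}
    (hα : IsQuasiAction α) {β : G → Y → Y} (hβ : Cobounded β) (h : ReducesTo α β) (x₀ : X) :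
    ∃ f : quasiOrbit α x₀ → Y, IsQuasiIsometry f := by
  obtain ⟨F, hF, M, hM, hM'⟩ := h
  obtain ⟨K, C, hK, hC, a₁, -, -, -⟩ := hα.exists_bounds
  obtain ⟨L, c, hL, hc, f₁, f₂⟩ := isQIEmbedding_iff.1 hF
  obtain ⟨y₀, D, hD, -, hD'⟩ := hβ
  have hL0 : 0 ≤ L := by linarith
  have hK0 : 0 ≤ K := by linarith
  choose γ hγ using fun a : quasiOrbit α x₀ => a.2
  set E : ℝ := M + (K * dist (F y₀) x₀ + C) with hE
  have hE0 : 0 ≤ E := by positivity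
  have near : ∀ g, dist (F (β g y₀)) (α g x₀) ≤ E := fun g =>
    (dist_triangle _ _ _).trans (add_le_add (hM' y₀ g) (a₁ g _ _))
  have near' : ∀ a : quasiOrbit α x₀, dist (F (β (γ a) y₀)) (a : X) ≤ E := fun a => by
    conv_lhs => rw [← hγ a]
    exact near (γ a)
  have near'' : ∀ a : quasiOrbit α x₀, dist (a : X) (F (β (γ a) y₀)) ≤ E := fun a => by
    rw [dist_comm]
    exact near' a
  refine ⟨fun a => β (γ a) y₀, isQuasiIsometry_iff.2 ⟨isQIEmbedding_iff.2
    ⟨L, L * (2 * E) + c + 2 * E, hL, by positivity, fun a b => ?_, fun a b => ?_⟩,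
    D + (L * (2 * E) + c), by positivity, Set.range_nonempty _, fun y => ?_⟩⟩
  · have h1 := dist_triangle4 (F (β (γ a) y₀)) (a : X) b (F (β (γ b) y₀))
    have h2 := mul_le_mul_of_nonneg_left (h1.trans (by linarith [near' a, near'' b] :
      _ ≤ dist (a : X) b + 2 * E)) hL0
    rw [Subtype.dist_eq]
    linarith [f₂ (β (γ a) y₀) (β (γ b) y₀)]
  · have h1 := dist_triangle4 (a : X) (F (β (γ a) y₀)) (F (β (γ b) y₀)) b
    have : 0 ≤ L * (2 * E) := by positivity
    rw [Subtype.dist_eq]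
    linarith [f₁ (β (γ a) y₀) (β (γ b) y₀), near'' a, near' b]
  · obtain ⟨_, ⟨g, rfl⟩, hg⟩ := hD' y
    refine ⟨_, ⟨⟨α g x₀, g, rfl⟩, rfl⟩, ?_⟩
    dsimp only at hg ⊢
    have h1 := near'' ⟨α g x₀, g, rfl⟩
    have h2 := mul_le_mul_of_nonneg_left ((dist_triangle _ _ _).trans (add_le_add (near g) h1)) hL0
    have h3 := f₂ (β g y₀) (β (γ ⟨α g x₀, g, rfl⟩) y₀)
    have h4 := dist_triangle y (β g y₀) (β (γ ⟨α g x₀, g, rfl⟩) y₀)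
    linarith

end QuasiOrbit

/-- A quasi-action reduces to a cobounded quasi-action on a bounded valence tree if and only if a
quasi-orbit is coarse connected and embeds in a proper space and in a tree. -/
theorem exists_reducesTo_tree_iff {G : Type u} [Group G] {X : Type v} [MetricSpace X]
    (α : G → X → X) (hα : IsQuasiAction α) (x₀ : X) :
    (∃ T : SimplicialTree.{w}, T.BoundedValence ∧
        ∃ β : G → T.Realization → T.Realization,
          IsQuasiAction β ∧ Cobounded β ∧ ReducesTo α β) ↔
      (∃ (Y : Type w) (_ : MetricSpace Y) (_ : ProperSpace Y) (q : quasiOrbit α x₀ → Y),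
          IsQIEmbedding q) ∧
        (∃ (T : SimplicialTree.{w}) (q : quasiOrbit α x₀ → T.Realization), IsQIEmbedding q) ∧
        CoarseConnected (quasiOrbit α x₀) := by
  constructor
  · rintro ⟨T, hT, β, -, hβ, h⟩
    obtain ⟨f, hf⟩ := h.exists_quasiIsometry hα hβ x₀
    obtain ⟨p, hp⟩ := T.exists_isQuasiIsometry_vertex
    have hf' := (isQuasiIsometry_iff.1 hf).1
    exact ⟨⟨T.Vertex, inferInstance, hT.properSpace, _, (isQuasiIsometry_iff.1 hp).1.comp hf'⟩,
      ⟨T, f, hf'⟩, .of_quasiIsometry hf T.coarseConnected_realization⟩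
  · rintro ⟨⟨Y, _, _, p, hp⟩, ⟨T, q, hq⟩, hc⟩
    -- Properness of `Y` is used only through bounded geometry of the quasi-orbit; the other two
    -- conditions then yield the tree.
    obtain ⟨T', hT', f, hf⟩ := (boundedGeometry_quasiOrbit hα hp).exists_boundedValence hc hq
    exact ⟨T', hT', exists_reducesTo_of_quasiIsometry hα hf⟩

end CoarseGeom

theorem mainTheorem2 {G : Type u} [Group G] {X : Type v} [MetricSpace X]
    (α : G → X → X) (hα : IsQuasiAction α) (x₀ : X) :
    ((∃ T : SimplicialTree.{w}, T.BoundedValence ∧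
        ∃ β : G → T.Realization → T.Realization,
          IsQuasiAction β ∧ Cobounded β ∧ ReducesTo α β) ↔
      (∃ (Y : Type w) (_ : MetricSpace Y) (_ : ProperSpace Y) (q : quasiOrbit α x₀ → Y),
          IsQIEmbedding q) ∧
        (∃ (T : SimplicialTree.{w}) (q : quasiOrbit α x₀ → T.Realization), IsQIEmbedding q) ∧
        CoarseConnected (quasiOrbit α x₀)) ∧
    (Cobounded α →
      ((∃ T : SimplicialTree.{w}, T.BoundedValence ∧
          ∃ β : G → T.Realization → T.Realization,
            IsQuasiAction β ∧ Cobounded β ∧ EquivalentTo α β) ↔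
        (∃ (Y : Type w) (_ : MetricSpace Y) (_ : ProperSpace Y) (q : quasiOrbit α x₀ → Y),
            IsQIEmbedding q) ∧
          (∃ (T : SimplicialTree.{w}) (q : quasiOrbit α x₀ → T.Realization), IsQIEmbedding q) ∧
          CoarseConnected (quasiOrbit α x₀))) := by
  refine ⟨exists_reducesTo_tree_iff α hα x₀, fun hα' => ?_⟩
  rw [← exists_reducesTo_tree_iff α hα x₀]
  constructor
  · rintro ⟨T, hT, β, hβ, hβ', h⟩
    exact ⟨T, hT, β, hβ, hβ', h.reducesTo hβ⟩
  · rintro ⟨T, hT, β, hβ, hβ', h⟩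
    have : Nonempty T.Realization := ⟨hβ'.choose⟩
    exact ⟨T, hT, β, hβ, hβ', h.equivalentTo hα hα'⟩
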